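/- Let $k\ge 1$ be an integer. For real $\alpha$ let $F_\alpha$ be the bosonic Fock module of charge $\alpha$ over $\mathbb C$: the module over the Heisenberg algebra $[a_m,a_n]=m\,\delta_{m+n,0}$ ($m,n\in\mathbb Z$) with basis the monomials in the $a_{-m}$ ($m\ge 1$) applied to the Fock vacuum $|\alpha\rangle$, where $a_0|\alpha\rangle=\alpha|\alpha\rangle$ and $a_m|\alpha\rangle=0$ for $m\geq 1$. On $V=\bigoplus_{n\in\mathbb Z}F_{n\sqrt{2k}}$ let $J^0_m=a_m/\sqrt{2k}$, and let $J^\pm_m$ ($m\in\mathbb Z$) be the modes of the spin-$k$ vertex operators $$J^\pm(z)=\sum_{m\in\mathbb Z}J^\pm_m z^{-m-k}=T_{\pm\sqrt{2k}}\;z^{\pm\sqrt{2k}\,a_0}\,\exp\Big(\pm\sqrt{2k}\sum_{m>0}\tfrac{a_{-m}}{m}z^m\Big)\exp\Big(\mp\sqrt{2k}\sum_{m>0}\tfrac{a_m}{m}z^{-m}\Big),$$ where $z^{\pm\sqrt{2k}\,a_0}$ acts on $F_{n\sqrt{2k}}$ as $z^{\pm 2kn}$, and $T_\beta$ maps $F_\alpha$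 to $F_{\alpha+\beta}$, commutes with all $a_m$, $m\ne 0$, and sends $|\alpha\rangle$ to $|\alpha+\beta\rangle$. Let $L_0=\frac12a_0^2+\sum_{m>0}a_{-m}a_m$. Then: (i) the modes $J^+_m,J^-_m,J^0_m$ ($m\in\mathbb Z$) generate $V$ from the charge-zero vacuum: applying all elements of the algebra generated by these operators to $|0\rangle$ yields all of $V=\bigoplus_{n\in\mathbb Z}F_{n\sqrt{2k}}$; (ii) the character of $V$ is $\chi_0$: $L_0$ is diagonalizable on $V$ with finite-dimensional eigenspaces $V_h$, and for every $\tau$ in the upper half plane, with $q^x=e^{2\pi i\tau x}$, $$\sum_{h}\dim(V_h)\,q^{h-1/24}=\chi_0(q)=\frac{\sum_{n\in\mathbb Z}q^{kn^2}}{\eta(q)},$$ where both series converge absolutely and $\eta(q)=q^{1/24}\prod_{n\ge1}(1-q^n)$; (iii) for either choice of sign and every integer $n\ge 0$ (the product being empty for $n=0$), $$J^\pm_{-(2n-1)k}\cdots J^\pm_{-3k}J^\pm_{-k}|0\rangle=|\pm n\sqrt{2k}\rangle .$$ -/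

import Mathlib

open scoped DirectSum UpperHalfPlane

noncomputable section

namespace ChiralBoson

/-- The vector space underlying each Fock module: polynomials in the commuting creation
operators `a_{-m}`, `m ≥ 1` (the variable `X m` is `a_{-m}`); `1` is the Fock vacuum. -/
abbrev Osc : Type := MvPolynomial ℕ+ ℂ

/-- The Fock module `F_α` of charge `α`, on which `a_0` acts as `α`. As a vector space it does
not depend on `α`. -/
abbrev Fock (_α : ℝ) : Type := Osc

/-- The creation operator `a_{-m}`, `m ≥ 1`. -/
def create (m : ℕ+) : Module.End ℂ Osc :=
  LinearMap.mulLeft ℂ (MvPolynomial.X m)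

/-- The annihilation operator `a_m`, `m ≥ 1`: it kills `1` and satisfies `[a_m, a_{-m}] = m`. -/
def annih (m : ℕ+) : Module.End ℂ Osc :=
  (m : ℂ) • (MvPolynomial.pderiv (R := ℂ) m).toLinearMap

/-- The Heisenberg operator `a_n`, `n ∈ ℤ`, on `F_α`. -/
def heis (α : ℝ) : ℤ → Module.End ℂ (Fock α)
  | .ofNat 0 => (α : ℂ) • 1
  | .ofNat (n + 1) => annih n.succPNat
  | .negSucc n => create n.succPNat

/-- The sum of a pointwise finite family of linear maps. -/
def pointwiseSum {ι M N : Type*} [AddCommGroup M] [Module ℂ M] [AddCommGroup N] [Module ℂ N]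
    (f : ι → M →ₗ[ℂ] N) (hf : ∀ v, (Function.support fun i => f i v).Finite) : M →ₗ[ℂ] N where
  toFun v := ∑ᶠ i, f i v
  map_add' v w := by
    simp only [map_add]
    exact finsum_add_distrib (hf v) (hf w)
  map_smul' c v := by
    simp only [map_smul, RingHom.id_apply]
    exact (smul_finsum' c (hf v)).symm

/-- The `N`-th coefficient of `exp f = ∑_j f^j / j!`, for a power series `f` with zero constant
term whose coefficients are operators (the terms with `j > N` do not contribute). -/
def expCoeff (f : PowerSeries (Module.End ℂ Osc)) (N : ℕ) : Module.End ℂ Osc :=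
  ∑ j ∈ Finset.range (N + 1), ((j.factorial : ℂ)⁻¹) • PowerSeries.coeff N (f ^ j)

/-- `β ∑_{m > 0} (a_{-m} / m) z^m`, a power series in `z`. -/
def creationExponent (β : ℝ) : PowerSeries (Module.End ℂ Osc) :=
  PowerSeries.mk fun m => if h : 0 < m then ((β : ℂ) / m) • create ⟨m, h⟩ else 0

/-- `-β ∑_{m > 0} (a_m / m) w^m`, a power series in `w = z⁻¹`. -/
def annihilationExponent (β : ℝ) : PowerSeries (Module.End ℂ Osc) :=
  PowerSeries.mk fun m => if h : 0 < m then (-(β : ℂ) / m) • annih ⟨m, h⟩ else 0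

/-- Polynomials of weighted degree at most `D`, where `X m` has weight `m`. -/
def lowLevel (D : ℤ) : Submodule ℂ Osc :=
  MvPolynomial.restrictSupport ℂ
    {d : ℕ+ →₀ ℕ | ((Finsupp.weight (fun m : ℕ+ => (m : ℕ)) d : ℕ) : ℤ) ≤ D}

/-- The operator `T` lowers the level by `M`. -/
def Lowers (T : Module.End ℂ Osc) (M : ℕ) : Prop :=
  ∀ (D : ℤ) (p : Osc), p ∈ lowLevel D → T p ∈ lowLevel (D - M)

theorem mem_lowLevel {D : ℤ} {p : Osc} :
    p ∈ lowLevel D ↔ ∀ d, p.coeff d ≠ 0 →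
      ((Finsupp.weight (fun m : ℕ+ => (m : ℕ)) d : ℕ) : ℤ) ≤ D := by
  unfold lowLevel
  rw [MvPolynomial.mem_restrictSupport_iff]
  constructor
  · intro h d hd
    exact h (by simpa using hd)
  · intro h d hd
    exact h d (by simpa using hd)

theorem exists_mem_lowLevel (p : Osc) : ∃ D : ℕ, p ∈ lowLevel D := by
  refine ⟨p.support.sup fun d => Finsupp.weight (fun m : ℕ+ => (m : ℕ)) d, ?_⟩
  rw [mem_lowLevel]
  intro d hd
  exact_mod_cast Finset.le_sup (f := fun d => Finsupp.weight (fun m : ℕ+ => (m : ℕ)) d)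
    (MvPolynomial.mem_support_iff.2 hd)

theorem eq_zero_of_mem_lowLevel {D : ℤ} (hD : D < 0) {p : Osc} (hp : p ∈ lowLevel D) : p = 0 := by
  ext d
  by_contra h
  have := mem_lowLevel.1 hp d (by simpa using h)
  omega

theorem lowers_annih (m : ℕ+) : Lowers (annih m) m := by
  intro D p hp
  rw [mem_lowLevel] at hp ⊢
  intro d hd
  have h : p.coeff (d + Finsupp.single m 1) ≠ 0 := by
    intro h0
    apply hd
    simp [annih, MvPolynomial.coeff_pderiv, h0]
  have := hp _ h
  rw [map_add, Finsupp.weight_single] at this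
  push_cast at this
  simp at this
  linarith

theorem Lowers.mul {S T : Module.End ℂ Osc} {M N : ℕ} (hS : Lowers S M) (hT : Lowers T N) :
    Lowers (S * T) (M + N) := by
  intro D p hp
  have := hS _ _ (hT _ _ hp)
  rw [sub_sub, add_comm (N : ℤ)] at this
  simpa using this

theorem Lowers.smul {T : Module.End ℂ Osc} {M : ℕ} (c : ℂ) (hT : Lowers T M) :
    Lowers (c • T) M :=
  fun D p hp => (lowLevel _).smul_mem c (hT D p hp)

theorem Lowers.sum {ι : Type*} {s : Finset ι} {T : ι → Module.End ℂ Osc} {M : ℕ}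
    (hT : ∀ i ∈ s, Lowers (T i) M) : Lowers (∑ i ∈ s, T i) M := by
  intro D p hp
  rw [LinearMap.sum_apply]
  exact Submodule.sum_mem _ fun i hi => hT i hi D p hp

theorem lowers_coeff_pow (β : ℝ) (j M : ℕ) :
    Lowers (PowerSeries.coeff M (annihilationExponent β ^ j)) M := by
  induction j generalizing M with
  | zero =>
    intro D p hp
    rw [pow_zero, PowerSeries.coeff_one]
    split_ifs with h
    · subst h
      simpa using hp
    · simp
  | succ j ih =>
    rw [pow_succ, PowerSeries.coeff_mul]
    refine Lowers.sum fun x hx => ?_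
    rw [← Finset.HasAntidiagonal.mem_antidiagonal.1 hx]
    refine (ih _).mul ?_
    rw [annihilationExponent, PowerSeries.coeff_mk]
    split_ifs with h
    · exact (lowers_annih ⟨x.2, h⟩).smul _
    · intro D p _
      simp

theorem lowers_expCoeff (β : ℝ) (M : ℕ) : Lowers (expCoeff (annihilationExponent β) M) M :=
  Lowers.sum fun j _ => (lowers_coeff_pow β j M).smul _

/-- The summand `A_{M+r} B_M` of `vertexCoeff`, with `A_N = 0` for `N < 0`. -/
def vertexTerm (β : ℝ) (r : ℤ) (M : ℕ) : Module.End ℂ Osc :=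
  if 0 ≤ (M : ℤ) + r then
    expCoeff (creationExponent β) ((M : ℤ) + r).toNat * expCoeff (annihilationExponent β) M
  else 0

theorem vertexTerm_finite (β : ℝ) (r : ℤ) (v : Osc) :
    (Function.support fun M => vertexTerm β r M v).Finite := by
  obtain ⟨D, hD⟩ := exists_mem_lowLevel v
  refine (Set.finite_Iic D).subset fun M hM => ?_
  by_contra h
  rw [Set.mem_Iic, not_le] at h
  apply hM
  have h0 := eq_zero_of_mem_lowLevel (by omega) (lowers_expCoeff β M D v hD)
  simp only [vertexTerm]
  split_ifs
  · simp [h0]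
  · simp

/-- The coefficient of `z^r` in the oscillator part
`exp(β ∑_{m>0} a_{-m} z^m / m) exp(-β ∑_{m>0} a_m z^{-m} / m)` of the vertex operator of charge
`β`: with `A_N`, `B_M` the coefficients of the two factors, it is `∑_M A_{M+r} B_M`. -/
def vertexCoeff (β : ℝ) (r : ℤ) : Module.End ℂ Osc :=
  pointwiseSum (vertexTerm β r) (vertexTerm_finite β r)

theorem number_finite (v : Osc) :
    (Function.support fun m : ℕ+ => (create m * annih m) v).Finite := by
  classical
  refine v.vars.finite_toSet.subset fun m hm => ?_
  by_contra h
  apply hm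
  simp [annih, MvPolynomial.pderiv_eq_zero_of_notMem_vars h]

/-- `L_0 = (1/2) a_0² + ∑_{m>0} a_{-m} a_m` on `F_α`. -/
def fockL0 (α : ℝ) : Module.End ℂ (Fock α) :=
  (1 / 2 : ℂ) • (heis α 0 * heis α 0) + pointwiseSum (fun m : ℕ+ => create m * annih m) number_finite

/-- The charge `n √(2k)`. -/
def charge (k : ℕ) (n : ℤ) : ℝ := n * Real.sqrt (2 * k)

/-- The space `⨁_{n ∈ ℤ} F_{n √(2k)}`. -/
abbrev Space (k : ℕ) : Type := ⨁ n : ℤ, Fock (charge k n)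

/-- The inclusion of the summand `F_{n √(2k)}`. -/
def incl (k : ℕ) (n : ℤ) : Fock (charge k n) →ₗ[ℂ] Space k :=
  DirectSum.lof ℂ ℤ (fun n => Fock (charge k n)) n

/-- The highest weight vector `|n √(2k)⟩` (the Fock vacuum of `F_{n √(2k)}`). -/
def hwv (k : ℕ) (n : ℤ) : Space k := incl k n (1 : Osc)

/-- `L_0` on the whole space. -/
def L0 (k : ℕ) : Module.End ℂ (Space k) :=
  DirectSum.toModule ℂ ℤ (Space k) fun n => incl k n ∘ₗ fockL0 (charge k n)

/-- The mode `J^0_m = a_m / √(2k)` of `J^0(z) = i ∂φ(z) / √(2k) = ∑_m J^0_m z^{-m-1}`. -/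
def J0 (k : ℕ) (m : ℤ) : Module.End ℂ (Space k) :=
  DirectSum.toModule ℂ ℤ (Space k) fun n =>
    incl k n ∘ₗ (((Real.sqrt (2 * k) : ℝ) : ℂ)⁻¹ • heis (charge k n) m)

/-- The mode `J^±_m` of `J^±(z) = e^{± i √(2k) φ(z)} = ∑_m J^±_m z^{-m-k}`, with `s = ±1` the sign.
On `F_α`, `α = n √(2k)`, the vertex operator of charge `β = s √(2k)` maps to `F_{α+β}`, and its
zero mode factor is `z^{β α} = z^{2 k s n}`; so `J^±_m` acts there as the coefficient of
`z^{-m-k-2ksn}` of the oscillator part. -/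
def J (k : ℕ) (s : ℤˣ) (m : ℤ) : Module.End ℂ (Space k) :=
  DirectSum.toModule ℂ ℤ (Space k) fun n =>
    incl k (n + s) ∘ₗ vertexCoeff (charge k s) (-m - k - 2 * k * s * n)

/-- The algebra of operators generated by all modes of the currents `J^+`, `J^-`, `J^0`. -/
def currentAlgebra (k : ℕ) : Subalgebra ℂ (Module.End ℂ (Space k)) :=
  Algebra.adjoin ℂ
    (Set.range (J k 1) ∪ Set.range (J k (-1)) ∪ Set.range (J0 k))

/-- The subspace generated from a vector `v` by the modes of the currents. -/
def generated (k : ℕ) (v : Space k) : Submodule ℂ (Space k) :=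
  (Subalgebra.toSubmodule (currentAlgebra k)).map (LinearMap.applyₗ v)

/-- `H` is diagonalizable with finite-dimensional eigenspaces, and at every `τ` in the upper half
plane `χ τ` is the (absolutely convergent) trace of `q^{H - 1/24}`, `q = e^{2πiτ}`. -/
def IsCharacter {V : Type*} [AddCommGroup V] [Module ℂ V] (H : Module.End ℂ V) (χ : ℍ → ℂ) :
    Prop :=
  (⨆ h : ℂ, H.eigenspace h) = ⊤ ∧
  (∀ h : ℂ, FiniteDimensional ℂ (H.eigenspace h)) ∧
  ∀ τ : ℍ, HasSum (fun h : ℂ => (Module.finrank ℂ (H.eigenspace h) : ℂ) *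
    Complex.exp (2 * Real.pi * Complex.I * τ * (h - 1 / 24))) (χ τ)

/-- `q^{k n²}` with `q = e^{2πiτ}`. -/
def thetaTerm (k : ℕ) (τ : ℍ) (n : ℤ) : ℂ :=
  Complex.exp (2 * Real.pi * Complex.I * τ * (k * (n : ℂ) ^ 2))

/-- `χ_0(q) = ∑_{n ∈ ℤ} q^{k n²} / η(q)`, `q = e^{2πiτ}`, with `η` the Dedekind eta function. -/
def chi0 (k : ℕ) (τ : ℍ) : ℂ := (∑' n : ℤ, thetaTerm k τ n) / ModularForm.eta τ

end ChiralBoson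

end

/-!
In charge `± i √(2k)` the factor `z^{± √(2k) a_0}` shifts the modes of `J^±` by `2ki`, so that
`J^±_{-(2i+1)k}` acts there as the coefficient of `z^0`; on the Fock vacuum only the constant terms
of the two exponentials contribute to it, and the vector is moved to the next Fock vacuum. All Fock
vacua are therefore reached from `|0⟩`, and `J^0_{-m}` multiplies by `a_{-m}` up to a nonzero
scalar, which fills up each Fock module.

The monomials in the `a_{-m}` form a basis of eigenvectors of `L_0`, of conformal weight
`k n² + ∑ m d_m`. Hence the character is the sum of `q^{weight - 1/24}` over that basis, regrouped
by weight, and it splits as the theta series times Euler's generating function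
`∑_d q^{∑ m d_m} = ∏ (1 - q^m)⁻¹`. The latter is the infinite distributive law for geometric
series: the sum over the `d` supported in a finite set `s` is `∏_{i ∈ s} (1 - f_i)⁻¹`, and dominated
convergence lets `s` grow.
-/

section GeneratingFunctions

open Filter Topology

theorem summable_norm_and_hasSum_prod_fin {n : ℕ} {α R : Type*} [NormedCommRing R]
    [CompleteSpace R] {g : Fin n → α → R} (hg : ∀ i, Summable fun a => ‖g i a‖) :
    (Summable fun d : Fin n → α => ‖∏ i, g i (d i)‖) ∧
      HasSum (fun d : Fin n → α => ∏ i, g i (d i)) (∏ i, ∑' a, g i a) := by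
  induction n with
  | zero => exact ⟨.of_finite, by simp⟩
  | succ n ih =>
    obtain ⟨hnorm, hsum⟩ := ih fun i => hg i.succ
    rw [← (Fin.consEquiv fun _ => α).summable_iff, ← (Fin.consEquiv fun _ => α).hasSum_iff]
    simp only [Function.comp_def, Fin.prod_univ_succ, Fin.consEquiv_apply, Fin.cons_zero,
      Fin.cons_succ]
    have hmulNorm := (hg 0).mul_norm hnorm
    have hmulSum := (hg 0).of_norm.hasSum.mul hsum hmulNorm.of_norm
    exact ⟨hmulNorm, hmulSum⟩

theorem hasSum_prod_pi {ι α R : Type*} [Fintype ι] [NormedCommRing R] [CompleteSpace R]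
    {g : ι → α → R} (hg : ∀ i, Summable fun a => ‖g i a‖) :
    HasSum (fun d : ι → α => ∏ i, g i (d i)) (∏ i, ∑' a, g i a) := by
  let e := (Fintype.equivFin ι).symm
  have hfin := (summable_norm_and_hasSum_prod_fin fun i => hg (e i)).2
  rw [e.prod_comp fun i => ∑' a, g i a] at hfin
  rw [← (e.arrowCongr (.refl α)).hasSum_iff]
  convert hfin with d
  exact (Fintype.prod_equiv e _ _ fun i => by simp).symm

variable {ι F : Type*} [NormedField F] {f : ι → F}

theorem hasSum_finsuppProd_pow_of_support_subset [CompleteSpace F] (hf : ∀ i, ‖f i‖ < 1)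
    (s : Finset ι) :
    HasSum (fun d : {d : ι →₀ ℕ // (d.support : Set ι) ⊆ s} => d.1.prod fun i e => f i ^ e)
      (∏ i ∈ s, (1 - f i)⁻¹) := by
  have hpi := hasSum_prod_pi (g := fun (i : (s : Set ι)) e => f i ^ e) fun i => by
    simpa using summable_geometric_of_lt_one (norm_nonneg _) (hf i)
  simp only [tsum_geometric_of_norm_lt_one (hf _)] at hpi
  rw [← ((Finsupp.restrictSupportEquiv (s : Set ι) ℕ).trans
    Finsupp.equivFunOnFinite).hasSum_iff] at hpi
  rw [← Finset.prod_coe_sort]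
  convert hpi using 2 with d
  exact (Finsupp.prod_subtypeDomain_index d.2).symm.trans (Finsupp.prod_pow _ _)

theorem hasProd_inv_one_sub [CompleteSpace F] (hf : ∀ i, f i ≠ 1)
    (hsum : Summable fun i => ‖f i‖) :
    HasProd (fun i => (1 - f i)⁻¹) (∏' i, (1 - f i))⁻¹ := by
  have hsum' : Summable fun i => ‖-f i‖ := by simpa only [norm_neg] using hsum
  have hne (i : ι) : 1 + -f i ≠ 0 := by
    rw [← sub_eq_add_neg]
    exact sub_ne_zero.2 (hf i).symm
  simpa only [← sub_eq_add_neg] using (multipliable_one_add_of_summable hsum').hasProd.inv₀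
    (tprod_one_add_ne_zero_of_summable hne hsum')

theorem summable_norm_finsuppProd_pow (hf : ∀ i, ‖f i‖ < 1) (hsum : Summable fun i => ‖f i‖) :
    Summable fun d : ι →₀ ℕ => ‖d.prod fun i e => f i ^ e‖ := by
  classical
  have hf' (i : ι) : ‖‖f i‖‖ < 1 := by simpa using hf i
  -- The finite products converge, so they are eventually bounded; each partial sum is at most
  -- one of them.
  have hprod := hasProd_inv_one_sub (fun i => (hf i).ne) (by simpa using hsum)
  obtain ⟨s, hs⟩ := eventually_atTop.1 (hprod.eventually_le_const (lt_add_one _))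
  refine summable_of_sum_le (c := (∏' i, (1 - ‖f i‖))⁻¹ + 1) (fun _ => norm_nonneg _) fun u => ?_
  set t := s ∪ u.biUnion Finsupp.support
  have ht : ∀ d ∈ u, (d.support : Set ι) ⊆ t := fun d hd => Finset.coe_subset.2 <|
    (Finset.subset_biUnion_of_mem Finsupp.support hd).trans Finset.subset_union_right
  calc ∑ d ∈ u, ‖d.prod fun i e => f i ^ e‖
      = ∑ d ∈ u, d.prod fun i e => ‖f i‖ ^ e := by simp only [Finsupp.prod, norm_prod, norm_pow]
    _ = ∑ d ∈ u.subtype fun d => (d.support : Set ι) ⊆ t, d.1.prod fun i e => ‖f i‖ ^ e :=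
        (Finset.sum_subtype_of_mem _ ht).symm
    _ ≤ ∏ i ∈ t, (1 - ‖f i‖)⁻¹ :=
        sum_le_hasSum _ (fun d _ => Finset.prod_nonneg fun i _ => by positivity)
          (hasSum_finsuppProd_pow_of_support_subset hf' t)
    _ ≤ (∏' i, (1 - ‖f i‖))⁻¹ + 1 := hs t Finset.subset_union_left

theorem hasSum_finsuppProd_pow [CompleteSpace F] (hf : ∀ i, ‖f i‖ < 1)
    (hsum : Summable fun i => ‖f i‖) :
    HasSum (fun d : ι →₀ ℕ => d.prod fun i e => f i ^ e) (∏' i, (1 - f i))⁻¹ := by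
  set g : (ι →₀ ℕ) → F := fun d => d.prod fun i e => f i ^ e
  have hg := summable_norm_finsuppProd_pow hf hsum
  have hlim : Tendsto (fun s : Finset ι => ∑' d, {d | (d.support : Set ι) ⊆ s}.indicator g d)
      atTop (𝓝 (∑' d, g d)) := by
    refine tendsto_tsum_of_dominated_convergence hg (fun d => ?_)
      (.of_forall fun s d => norm_indicator_le_norm_self _ _)
    refine tendsto_const_nhds.congr' ?_
    filter_upwards [eventually_ge_atTop d.support] with s hs
    exact (Set.indicator_of_mem (Finset.coe_subset.2 hs) g).symm
  have hprod (s : Finset ι) :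
      ∑' d, {d | (d.support : Set ι) ⊆ s}.indicator g d = ∏ i ∈ s, (1 - f i)⁻¹ :=
    (tsum_subtype _ _).symm.trans (hasSum_finsuppProd_pow_of_support_subset hf s).tsum_eq
  have htsum : (∏' i, (1 - f i))⁻¹ = ∑' d, g d := by
    refine tendsto_nhds_unique (f := fun s => ∏ i ∈ s, (1 - f i)⁻¹) (l := atTop)
      (hasProd_inv_one_sub (fun i h => by simpa [h] using hf i) hsum) ?_
    simpa only [hprod] using hlim
  exact htsum ▸ hg.of_norm.hasSum

end GeneratingFunctions

section Fibres

variable {ι X E : Type*} [AddCommGroup E] {w : ι → X} {g : X → E}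

theorem finite_preimage_singleton_of_summable_comp [TopologicalSpace E] [IsTopologicalAddGroup E]
    [T1Space E] (hs : Summable fun i => g (w i)) {x : X} (hx : g x ≠ 0) :
    (w ⁻¹' {x}).Finite := by
  refine (Filter.eventually_cofinite.1 (hs.tendsto_cofinite_zero.eventually_ne hx.symm)).subset ?_
  rintro i rfl
  exact not_not.2 rfl

theorem hasSum_natCard_preimage_nsmul [UniformSpace E] [IsUniformAddGroup E]
    [CompleteSpace E] [T2Space E] {a : E} (hs : HasSum (fun i => g (w i)) a) :
    HasSum (fun x => Nat.card (w ⁻¹' {x}) • g x) a := by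
  have hfibre (x : X) : ∑' i : w ⁻¹' {x}, g (w i) = Nat.card (w ⁻¹' {x}) • g x := by
    rw [← tsum_const, tsum_congr fun i : w ⁻¹' {x} => congrArg g i.2]
  simpa only [hfibre] using hs.tsum_fiberwise w

end Fibres

section Eigenbasis

variable {ι R V : Type*} [CommRing R] [AddCommGroup V] [Module R V]
  {H : Module.End R V} {b : Module.Basis ι R V} {w : ι → R}

theorem repr_apply_of_eigenbasis (hb : ∀ i, H (b i) = w i • b i) (x : V) (i : ι) :
    b.repr (H x) i = w i * b.repr x i := by
  classical
  have hcoord : b.coord i ∘ₗ H = w i • b.coord i := b.ext fun j => by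
    by_cases hij : j = i
    · simp [hij, hb]
    · simp [hij, hb]
  exact LinearMap.congr_fun hcoord x

theorem eigenspace_eq_span_of_eigenbasis [IsDomain R] (hb : ∀ i, H (b i) = w i • b i) (h : R) :
    H.eigenspace h = Submodule.span R (b '' (w ⁻¹' {h})) := by
  ext x
  have hcoord : H x = h • x ↔ ∀ i, w i * b.repr x i = h * b.repr x i := by
    simp [b.ext_elem_iff, repr_apply_of_eigenbasis hb]
  simp only [Module.End.mem_eigenspace_iff, hcoord, b.mem_span_image, mul_eq_mul_right_iff,
    Set.subset_def, Finset.mem_coe, Finsupp.mem_support_iff, Set.mem_preimage,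
    Set.mem_singleton_iff, or_iff_not_imp_right]

theorem finrank_eigenspace_of_eigenbasis [IsDomain R] (hb : ∀ i, H (b i) = w i • b i) (h : R) :
    Module.finrank R (H.eigenspace h) = Nat.card (w ⁻¹' {h}) := by
  rw [eigenspace_eq_span_of_eigenbasis hb, Set.image_eq_range]
  exact Module.finrank_eq_nat_card_basis
    (Module.Basis.span (b.linearIndependent.comp _ Subtype.val_injective))

theorem iSup_eigenspace_eq_top_of_eigenbasis (hb : ∀ i, H (b i) = w i • b i) :
    ⨆ h, H.eigenspace h = ⊤ := by
  rw [eq_top_iff, ← b.span_eq, Submodule.span_le]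
  rintro _ ⟨i, rfl⟩
  exact Submodule.mem_iSup_of_mem (w i) (Module.End.mem_eigenspace_iff.2 (hb i))

end Eigenbasis

namespace ChiralBoson

open MvPolynomial

section HighestWeightVectors

theorem one_mem_lowLevel_zero : (1 : Osc) ∈ lowLevel 0 := by
  refine mem_lowLevel.2 fun d hd => ?_
  have hd0 : d = 0 := by
    by_contra h
    exact hd (by rw [coeff_one, if_neg (Ne.symm h)])
  simp [hd0]

theorem expCoeff_zero (f : PowerSeries (Module.End ℂ Osc)) : expCoeff f 0 = 1 := by
  simp [expCoeff]

theorem expCoeff_annihilationExponent_one (β : ℝ) {M : ℕ} (hM : M ≠ 0) :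
    expCoeff (annihilationExponent β) M 1 = 0 :=
  eq_zero_of_mem_lowLevel (by omega) (lowers_expCoeff β M 0 1 one_mem_lowLevel_zero)

theorem vertexCoeff_natCast_one (β : ℝ) (N : ℕ) :
    vertexCoeff β N 1 = expCoeff (creationExponent β) N 1 := by
  change ∑ᶠ M, vertexTerm β N M 1 = _
  rw [finsum_eq_single _ 0 fun M hM => ?_]
  · simp [vertexTerm, expCoeff_zero]
  · simp only [vertexTerm]
    split_ifs <;> simp [expCoeff_annihilationExponent_one β hM]

theorem J_incl (k : ℕ) (s : ℤˣ) (m n : ℤ) (v : Osc) :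
    J k s m (incl k n v) =
      incl k (n + s) (vertexCoeff (charge k s) (-m - k - 2 * k * s * n) v) := by
  simp [J, incl]

theorem J_hwv (k : ℕ) (s : ℤˣ) (i : ℤ) :
    J k s (-((2 * i + 1) * k)) (hwv k (s * i)) = hwv k (s * (i + 1)) := by
  have hs : (s : ℤ) * s = 1 := by rw [← Units.val_mul, Int.units_mul_self, Units.val_one]
  have hmode : -(-((2 * i + 1) * k)) - k - 2 * k * s * (s * i) = ((0 : ℕ) : ℤ) := by
    push_cast
    linear_combination (-2 * k * i) * hs
  rw [hwv, J_incl, hmode, vertexCoeff_natCast_one, expCoeff_zero, Module.End.one_apply, hwv,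
    mul_add, mul_one]

theorem prod_J_hwv (k : ℕ) (s : ℤˣ) (n : ℕ) :
    (((List.range n).reverse.map fun i : ℕ => J k s (-((2 * (i : ℤ) + 1) * k))).prod)
      (hwv k 0) = hwv k (s * n) := by
  induction n with
  | zero => simp
  | succ n ih =>
    rw [List.range_succ, List.reverse_append, List.map_append, List.prod_append,
      Module.End.mul_apply, ih]
    simpa using J_hwv k s n

end HighestWeightVectors

section Generation

theorem J0_neg_incl (k : ℕ) (m : ℕ+) (n : ℤ) (v : Osc) :
    J0 k (-(m : ℕ)) (incl k n v) = ((Real.sqrt (2 * k) : ℝ) : ℂ)⁻¹ • incl k n (X m * v) := by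
  have hheis : heis (charge k n) (-(m : ℕ)) = create m := by
    obtain ⟨j, rfl⟩ : ∃ j : ℕ, m = j.succPNat := ⟨m.natPred, (PNat.succPNat_natPred m).symm⟩
    rfl
  simp [J0, incl, hheis, create]

theorem J_mem_currentAlgebra (k : ℕ) (s : ℤˣ) (m : ℤ) : J k s m ∈ currentAlgebra k := by
  refine Algebra.subset_adjoin (Or.inl ?_)
  obtain rfl | rfl := Int.units_eq_one_or s
  · exact Or.inl ⟨m, rfl⟩
  · exact Or.inr ⟨m, rfl⟩

theorem J0_mem_currentAlgebra (k : ℕ) (m : ℤ) : J0 k m ∈ currentAlgebra k :=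
  Algebra.subset_adjoin (Or.inr ⟨m, rfl⟩)

theorem mem_generated_self (k : ℕ) (v : Space k) : v ∈ generated k v :=
  ⟨1, (currentAlgebra k).one_mem, rfl⟩

theorem map_mem_generated {k : ℕ} {v w : Space k} {T : Module.End ℂ (Space k)}
    (hT : T ∈ currentAlgebra k) (hw : w ∈ generated k v) : T w ∈ generated k v := by
  obtain ⟨S, hS, rfl⟩ := hw
  exact ⟨T * S, (currentAlgebra k).mul_mem hT hS, rfl⟩

theorem hwv_units_mul_mem_generated (k : ℕ) (s : ℤˣ) (n : ℕ) :
    hwv k (s * n) ∈ generated k (hwv k 0) := by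
  rw [← prod_J_hwv]
  refine map_mem_generated (list_prod_mem fun T hT => ?_) (mem_generated_self k _)
  obtain ⟨i, -, rfl⟩ := List.mem_map.1 hT
  exact J_mem_currentAlgebra k s _

theorem hwv_mem_generated (k : ℕ) (n : ℤ) : hwv k n ∈ generated k (hwv k 0) := by
  obtain ⟨m, rfl | rfl⟩ := n.eq_nat_or_neg
  · simpa using hwv_units_mul_mem_generated k 1 m
  · simpa using hwv_units_mul_mem_generated k (-1) m

theorem incl_X_mul_mem_generated {k : ℕ} (hk : 0 < k) {v : Space k} {n : ℤ} {p : Osc}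
    (hp : incl k n p ∈ generated k v) (m : ℕ+) : incl k n (X m * p) ∈ generated k v := by
  have hc : ((Real.sqrt (2 * k) : ℝ) : ℂ) ≠ 0 :=
    Complex.ofReal_ne_zero.2 (Real.sqrt_pos.2 (by positivity)).ne'
  have hJ0 := Submodule.smul_mem _ ((Real.sqrt (2 * k) : ℝ) : ℂ)
    (map_mem_generated (J0_mem_currentAlgebra k (-(m : ℕ))) hp)
  rwa [J0_neg_incl, smul_inv_smul₀ hc] at hJ0

theorem incl_mem_generated {k : ℕ} (hk : 0 < k) {v : Space k} {n : ℤ}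
    (hn : hwv k n ∈ generated k v) (p : Osc) : incl k n p ∈ generated k v := by
  induction p using MvPolynomial.induction_on with
  | C a =>
    rw [← mul_one (C a), C_mul', map_smul]
    exact Submodule.smul_mem _ _ hn
  | add p q hp hq =>
    rw [map_add]
    exact add_mem hp hq
  | mul_X p m hp =>
    rw [mul_comm]
    exact incl_X_mul_mem_generated hk hp m

theorem generated_hwv_zero {k : ℕ} (hk : 0 < k) : generated k (hwv k 0) = ⊤ := by
  refine eq_top_iff.2 fun v _ => ?_
  induction v using DirectSum.induction_on with
  | zero => exact zero_mem _
  | of n p => exact incl_mem_generated hk (hwv_mem_generated k n) p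
  | add v w hv hw => exact add_mem (hv trivial) (hw trivial)

end Generation

section Spectrum

/-- The level `∑ m d_m` of the monomial `∏ a_{-m}^{d_m}`, the eigenvalue on it of the oscillator
part of `L_0`. -/
noncomputable abbrev level : (ℕ+ →₀ ℕ) →+ ℕ := Finsupp.weight fun m : ℕ+ => (m : ℕ)

theorem create_mul_annih_monomial (m : ℕ+) (d : ℕ+ →₀ ℕ) (c : ℂ) :
    (create m * annih m) (monomial d c) = ((d m * m : ℕ) : ℂ) • (monomial d c : Osc) := by
  simp only [create, annih, Module.End.mul_apply, LinearMap.smul_apply, LinearMap.mulLeft_apply,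
    mul_smul_comm, Derivation.coeFn_coe, X_mul_pderiv_monomial]
  rw [← Nat.cast_smul_eq_nsmul ℂ, smul_smul, ← Nat.cast_mul, mul_comm]

/-- The number operator `∑_{m > 0} a_{-m} a_m`, the oscillator part of `L_0`. -/
noncomputable def number : Module.End ℂ Osc :=
  pointwiseSum (fun m : ℕ+ => create m * annih m) number_finite

theorem number_monomial (d : ℕ+ →₀ ℕ) (c : ℂ) :
    number (monomial d c) = (level d : ℂ) • (monomial d c : Osc) := by
  change ∑ᶠ m : ℕ+, (create m * annih m) (monomial d c) = _
  simp only [create_mul_annih_monomial]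
  rw [finsum_eq_sum_of_support_subset (s := d.support), ← Finset.sum_smul, ← Nat.cast_sum,
    Finsupp.weight_apply, Finsupp.sum]
  · simp only [smul_eq_mul]
  · intro m hm
    rw [Finset.mem_coe, Finsupp.mem_support_iff]
    rintro h
    exact hm (by simp [h])

theorem fockL0_eq_smul_one_add_number (α : ℝ) :
    fockL0 α = ((α : ℂ) ^ 2 / 2) • 1 + number := by
  have hzero : heis α 0 = (α : ℂ) • 1 := rfl
  rw [fockL0, number, hzero, smul_mul_smul_comm, mul_one, smul_smul]
  congr 2
  ring

theorem charge_sq_div_two (k : ℕ) (n : ℤ) : (charge k n : ℂ) ^ 2 / 2 = k * (n : ℂ) ^ 2 := by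
  have hreal : charge k n ^ 2 / 2 = k * (n : ℝ) ^ 2 := by
    rw [charge, mul_pow, Real.sq_sqrt (by positivity)]
    ring
  exact_mod_cast congrArg Complex.ofReal hreal

theorem L0_incl (k : ℕ) (n : ℤ) (p : Osc) :
    L0 k (incl k n p) = incl k n (fockL0 (charge k n) p) := by
  simp [L0, incl]

/-- The basis of `⨁ F_{n √(2k)}` formed by the monomials in the creation operators applied to the
Fock vacua, the pair `⟨n, d⟩` standing for `∏ a_{-m}^{d_m} |n √(2k)⟩`. -/
noncomputable def monomialBasis (k : ℕ) : Module.Basis (Σ _ : ℤ, ℕ+ →₀ ℕ) ℂ (Space k) :=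
  DFinsupp.basis fun _ : ℤ => basisMonomials ℕ+ ℂ

theorem monomialBasis_apply (k : ℕ) (n : ℤ) (d : ℕ+ →₀ ℕ) :
    monomialBasis k ⟨n, d⟩ = incl k n (monomial d 1) := by
  classical
  -- `DFinsupp.basis` has no evaluation lemma, so its coordinate map is spelled out.
  change (DFinsupp.mapRange.linearEquiv fun _ : ℤ => (basisMonomials ℕ+ ℂ).repr).symm
    (sigmaFinsuppEquivDFinsupp (Finsupp.single (⟨n, d⟩ : Σ _ : ℤ, ℕ+ →₀ ℕ) (1 : ℂ))) = _
  rw [sigmaFinsuppEquivDFinsupp_single]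
  exact DFinsupp.mapRange_single (hf := fun _ => map_zero _)

/-- The conformal weight `k n² + ∑ m d_m` of the basis vector `∏ a_{-m}^{d_m} |n √(2k)⟩`, its
eigenvalue under `L_0`. -/
noncomputable def conformalWeight (k : ℕ) (i : Σ _ : ℤ, ℕ+ →₀ ℕ) : ℂ :=
  k * (i.1 : ℂ) ^ 2 + level i.2

theorem L0_monomialBasis (k : ℕ) (i : Σ _ : ℤ, ℕ+ →₀ ℕ) :
    L0 k (monomialBasis k i) = conformalWeight k i • monomialBasis k i := by
  obtain ⟨n, d⟩ := i
  rw [monomialBasis_apply, L0_incl, fockL0_eq_smul_one_add_number, charge_sq_div_two,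
    LinearMap.add_apply, number_monomial, LinearMap.smul_apply, Module.End.one_apply, ← add_smul,
    map_smul, conformalWeight]

end Spectrum

section Character

/-- `q^x` for `q = e^{2πiτ}` and a complex exponent `x`, on the branch given by `τ`. -/
noncomputable def qPow (τ : ℍ) (x : ℂ) : ℂ := Complex.exp (2 * Real.pi * Complex.I * τ * x)

theorem qPow_ne_zero (τ : ℍ) (x : ℂ) : qPow τ x ≠ 0 := Complex.exp_ne_zero _

theorem qPow_add (τ : ℍ) (x y : ℂ) : qPow τ (x + y) = qPow τ x * qPow τ y := by
  rw [qPow, mul_add, Complex.exp_add, qPow, qPow]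

theorem qPow_sub (τ : ℍ) (x y : ℂ) : qPow τ (x - y) = qPow τ x / qPow τ y := by
  rw [qPow, mul_sub, Complex.exp_sub, qPow, qPow]

theorem qPow_natCast (τ : ℍ) (n : ℕ) : qPow τ n = qPow τ 1 ^ n := by
  rw [qPow, qPow, ← Complex.exp_nat_mul, mul_one, mul_comm]

theorem norm_qPow_one_lt_one (τ : ℍ) : ‖qPow τ 1‖ < 1 := by
  simpa [qPow] using UpperHalfPlane.norm_exp_two_pi_I_lt_one τ

theorem thetaTerm_eq_qPow (k : ℕ) (τ : ℍ) (n : ℤ) : thetaTerm k τ n = qPow τ (k * (n : ℂ) ^ 2) :=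
  rfl

theorem IsCharacter.of_eigenbasis {V ι : Type*} [AddCommGroup V] [Module ℂ V]
    {H : Module.End ℂ V} (b : Module.Basis ι ℂ V) {w : ι → ℂ} (hb : ∀ i, H (b i) = w i • b i)
    {χ : ℍ → ℂ} (hχ : ∀ τ : ℍ, HasSum (fun i => qPow τ (w i - 1 / 24)) (χ τ)) :
    IsCharacter H χ := by
  refine ⟨iSup_eigenspace_eq_top_of_eigenbasis hb, fun h => ?_, fun τ => ?_⟩
  · have hfin : (w ⁻¹' {h}).Finite := finite_preimage_singleton_of_summable_comp
      (g := fun x => qPow UpperHalfPlane.I (x - 1 / 24)) (hχ _).summable (qPow_ne_zero _ _)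
    rw [eigenspace_eq_span_of_eigenbasis hb]
    exact FiniteDimensional.span_of_finite ℂ (hfin.image b)
  · have htrace := hasSum_natCard_preimage_nsmul (g := fun x => qPow τ (x - 1 / 24)) (hχ τ)
    simp only [nsmul_eq_mul, ← finrank_eigenspace_of_eigenbasis hb] at htrace
    exact htrace

theorem eta_eq_qPow_mul_tprod (τ : ℍ) :
    ModularForm.eta τ = qPow τ (1 / 24) * ∏' n : ℕ, (1 - qPow τ 1 ^ (n + 1)) := by
  simp only [ModularForm.eta, ModularForm.eta_q_eq_pow, Function.Periodic.qParam, qPow]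
  simp [div_eq_mul_inv]

theorem hasSum_pow_level {q : ℂ} (hq : ‖q‖ < 1) :
    HasSum (fun d => q ^ level d) (∏' n : ℕ, (1 - q ^ (n + 1)))⁻¹ := by
  have hpow (d : ℕ+ →₀ ℕ) : q ^ level d = d.prod fun m e => (q ^ (m : ℕ)) ^ e := by
    simp only [Finsupp.weight_apply, Finsupp.sum, Finsupp.prod, Finset.prod_pow_eq_pow_sum,
      ← pow_mul', smul_eq_mul]
  simp only [hpow, ← tprod_pnat_eq_tprod_succ (f := fun n => 1 - q ^ n)]
  refine hasSum_finsuppProd_pow (fun m => ?_) ?_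
  · rw [norm_pow]
    exact pow_lt_one₀ (norm_nonneg q) hq m.ne_zero
  · simpa only [norm_pow, Function.comp_def] using
      (summable_geometric_of_lt_one (norm_nonneg q) hq).comp_injective PNat.coe_injective

theorem summable_thetaTerm {k : ℕ} (hk : 0 < k) (τ : ℍ) : Summable (thetaTerm k τ) := by
  have hterm : thetaTerm k τ = fun n => jacobiTheta₂_term n 0 (2 * k * τ) := by
    funext n
    rw [thetaTerm, jacobiTheta₂_term]
    ring_nf
  have him : (2 * k * τ : ℂ).im = 2 * k * τ.im := by
    rw [← Complex.ofReal_natCast, ← Complex.ofReal_ofNat, ← Complex.ofReal_mul,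
      Complex.im_ofReal_mul, UpperHalfPlane.coe_im]
  rw [hterm, summable_jacobiTheta₂_term_iff, him]
  have := τ.im_pos
  positivity

theorem hasSum_qPow_conformalWeight {k : ℕ} (hk : 0 < k) (τ : ℍ) :
    HasSum (fun i => qPow τ (conformalWeight k i - 1 / 24)) (chi0 k τ) := by
  have hθ := summable_thetaTerm hk τ
  have hp := hasSum_pow_level (norm_qPow_one_lt_one τ)
  have hmul := summable_mul_of_summable_norm hθ.norm hp.summable.norm
  have hprod := (hθ.hasSum.mul hp hmul).div_const (qPow τ (1 / 24))
  have hchi : chi0 k τ = (∑' n, thetaTerm k τ n) * (∏' n : ℕ, (1 - qPow τ 1 ^ (n + 1)))⁻¹ /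
      qPow τ (1 / 24) := by
    rw [chi0, eta_eq_qPow_mul_tprod]
    ring
  rw [hchi]
  refine ((Equiv.sigmaEquivProd ℤ (ℕ+ →₀ ℕ)).hasSum_iff.2 hprod).congr_fun ?_
  rintro ⟨n, d⟩
  rw [qPow_sub, conformalWeight, qPow_add, qPow_natCast, ← thetaTerm_eq_qPow]
  rfl

end Character

end ChiralBoson

theorem lemma2 (k : ℕ) (hk : 0 < k) :
    ChiralBoson.generated k (ChiralBoson.hwv k 0) = ⊤ ∧
    (∀ τ : ℍ, Summable (ChiralBoson.thetaTerm k τ)) ∧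
    ChiralBoson.IsCharacter (ChiralBoson.L0 k) (ChiralBoson.chi0 k) ∧
    ∀ (s : ℤˣ) (n : ℕ),
      (((List.range n).reverse.map fun i : ℕ =>
        ChiralBoson.J k s (-((2 * (i : ℤ) + 1) * k))).prod) (ChiralBoson.hwv k 0) =
      ChiralBoson.hwv k (s * n) :=
  ⟨ChiralBoson.generated_hwv_zero hk, ChiralBoson.summable_thetaTerm hk,
    .of_eigenbasis (ChiralBoson.monomialBasis k) (ChiralBoson.L0_monomialBasis k)
      (ChiralBoson.hasSum_qPow_conformalWeight hk),
    ChiralBoson.prod_J_hwv k⟩
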